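/- **Setting.** All objects are smooth and real. Let $X\subseteq\mathbb R^p$ and $M\subseteq\mathbb R^n$ be open sets (coordinate domains of a $p$-dimensional and an $n$-dimensional manifold), and let an $r$-dimensional local Lie group $G$ act smoothly and locally on $M$; that is, $g\cdot u\in M$ is defined for $(g,u)$ in an open set containing $\{e\}\times M$, with $e\cdot u=u$, with $g\cdot(h\cdot u)=(gh)\cdot u$ whenever both sides are defined, and with $g^{-1}\cdot(g\cdot u)$ defined whenever $g\cdot u$ and $g^{-1}$ are. Let $J^k(X,M)$ be the bundle of $k$-jets of local sections of $X\times M\to X$. For $f$ defined near $x\in X$ with values in $M$, let $j^kf(x)\in J^k(X,M)$ denote the $k$-jet at $x$ of the graph $y\mapsto(y,f(y))$. The group acts locally on $X\times M$ by the verticalized action $g\cdot(x,u)=(x,g\cdot u)$, and on $J^k(X,M)$ by its prolongation $g\cdot j^kf(x)=j^k(g\cdot f)(x)$. Let $U\subseteq J^k(X,M)$ be open (for example $U=J^k(X,M)$). A coframe field $\{\omega^i\}$ on $U$ is *$G$-invariant* if $g^*\omega^i=\omega^i$ wherever both sides are defined, and *of constant structure* if $d\omega^i=-\tfrac12\sum_{j,l}C^i_{jl}\,\omega^j\wedge\omega^l$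 with constants $C^i_{jl}=-C^i_{lj}$. Maps $\psi,\varphi$ are *(fixed-parameter) congruent at* $x_0$ if there is $g\in G$ such that $\psi=g\cdot\varphi$ on a neighbourhood of $x_0$. A *congruence invariant of differential order at most $N$* is a smooth real function, invariant under the prolonged action, on the set of all $j^N\varphi(x)$, where $\varphi$ is an immersion of an open subset of $X$ into $M$ with $j^k\varphi(x)\in U$. A finite set $S$ of such functions is *complete* if, for all immersions $\psi,\varphi:W\to M$ of an open set $W\subseteq X$ and all $x_0\in W$ with $j^k\psi(x_0),j^k\varphi(x_0)\in U$, the maps $\psi$ and $\varphi$ are congruent at $x_0$ if and only if 1. $j^k\psi(x_0)=g\cdot j^k\varphi(x_0)$ for some $g\in G$, and 2. $I(j^N\psi(x))=I(j^N\varphi(x))$ for all $I\in S$ and all $x$ in a neighbourhood of $x_0$. **Corollary 4.11.** Suppose that $U$ admits a $G$-invariant coframe field of constant structure. Then complete sets of congruence invariants exist, and the least integer $d$ such that there is a complete set of congruence invariants of differential order at most $d$ satisfies $d\le k+1$. Moreover, among the complete sets of differential order at most $d$ there is a minimal one, that is, one no proper subset of which is complete. -/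

import Mathlib

open Set Filter Topology
open scoped Manifold ContDiff

noncomputable section

/-! ### Local Lie groups and local actions -/

/-- The coordinate space `ℝⁿ`. -/
abbrev Euc (n : ℕ) : Type := EuclideanSpace ℝ (Fin n)

/-- An `r`-dimensional local Lie group structure on a smooth `r`-dimensional manifold `G`:
a multiplication and an inversion that are defined and smooth on open sets, with an identity
element, and with the group laws wherever the expressions in them are defined. Values of `mul`
and `inv` outside of `mulDom` and `invDom` carry no meaning. Every Lie group, and every
neighbourhood of the identity element of a Lie group, is an example. -/
structure LocalLieGroup (r : ℕ) (G : Type*) [TopologicalSpace G] [ChartedSpace (Euc r) G] where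
  one : G
  mulDom : Set (G × G)
  mul : G → G → G
  invDom : Set G
  inv : G → G
  isOpen_mulDom : IsOpen mulDom
  isOpen_invDom : IsOpen invDom
  contMDiffOn_mul : ContMDiffOn ((𝓡 r).prod (𝓡 r)) (𝓡 r) ∞ (fun q : G × G => mul q.1 q.2) mulDom
  contMDiffOn_inv : ContMDiffOn (𝓡 r) (𝓡 r) ∞ inv invDom
  one_mul_mem : ∀ g, (one, g) ∈ mulDom
  mul_one_mem : ∀ g, (g, one) ∈ mulDom
  one_mul : ∀ g, mul one g = g
  mul_one : ∀ g, mul g one = g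
  mul_assoc : ∀ g h l, (g, h) ∈ mulDom → (h, l) ∈ mulDom → (mul g h, l) ∈ mulDom →
    (g, mul h l) ∈ mulDom → mul (mul g h) l = mul g (mul h l)
  one_mem_invDom : one ∈ invDom
  inv_mul_mem : ∀ g ∈ invDom, (inv g, g) ∈ mulDom
  mul_inv_mem : ∀ g ∈ invDom, (g, inv g) ∈ mulDom
  inv_mul : ∀ g ∈ invDom, mul (inv g) g = one
  mul_inv : ∀ g ∈ invDom, mul g (inv g) = one

/-- A smooth local (left) action of the local Lie group `L` on the open set `M ⊆ ℝⁿ`: the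
element `g • u = act g u` of `M` is defined for `(g, u)` in an open set `dom` that contains
`{e} × M`. Values of `act` outside of `dom` carry no meaning. -/
structure LocalAction {r : ℕ} {G : Type*} [TopologicalSpace G] [ChartedSpace (Euc r) G]
    (L : LocalLieGroup r G) {n : ℕ} (M : Set (Euc n)) where
  dom : Set (G × Euc n)
  act : G → Euc n → Euc n
  isOpen_dom : IsOpen dom
  contMDiffOn_act : ContMDiffOn ((𝓡 r).prod 𝓘(ℝ, Euc n)) 𝓘(ℝ, Euc n) ∞
    (fun q : G × Euc n => act q.1 q.2) dom
  mem_of_dom : ∀ g u, (g, u) ∈ dom → u ∈ M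
  act_mem : ∀ g u, (g, u) ∈ dom → act g u ∈ M
  one_mem : ∀ u ∈ M, (L.one, u) ∈ dom
  one_act : ∀ u ∈ M, act L.one u = u
  mul_act : ∀ g h u, (h, u) ∈ dom → (g, act h u) ∈ dom → (g, h) ∈ L.mulDom →
    (L.mul g h, u) ∈ dom → act (L.mul g h) u = act g (act h u)
  inv_mem : ∀ g u, (g, u) ∈ dom → g ∈ L.invDom → (L.inv g, act g u) ∈ dom

/-! ### Jets -/

/-- The space of symmetric `m`-linear maps `ℝᵖ × ⋯ × ℝᵖ → ℝⁿ`. Its coordinates are the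
`u^α_J = (T (e_{j₁}, …, e_{jₘ}))^α`, where `J = (j₁, …, jₘ)` is a symmetric multi-index. -/
def SymMul (p n m : ℕ) : Submodule ℝ (ContinuousMultilinearMap ℝ (fun _ : Fin m => Euc p) (Euc n))
    where
  carrier := {T | ∀ (σ : Equiv.Perm (Fin m)) (v : Fin m → Euc p), T (fun i => v (σ i)) = T v}
  add_mem' := by
    intro S T hS hT σ v
    simp [hS σ v, hT σ v]
  zero_mem' := by
    intro σ v
    simp
  smul_mem' := by
    intro c T hT σ v
    simp [hT σ v]

/-- Symmetrization of a multilinear map; it fixes the symmetric ones. -/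
def symmetrize {p n m : ℕ} (T : ContinuousMultilinearMap ℝ (fun _ : Fin m => Euc p) (Euc n)) :
    SymMul p n m :=
  ⟨((m.factorial : ℝ)⁻¹) • ∑ τ : Equiv.Perm (Fin m), T.domDomCongr τ, by
    intro σ v
    simp only [_root_.smul_apply, _root_.sum_apply,
      ContinuousMultilinearMap.domDomCongr_apply]
    congr 1
    exact Fintype.sum_equiv (Equiv.mulLeft σ) _ _ (fun τ => rfl)⟩

/-- The space `J^k(ℝᵖ, ℝⁿ)` of `k`-jets of sections of `ℝᵖ × ℝⁿ → ℝᵖ` in its standard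
coordinates: the point `x` of the base and the derivatives of orders `0, …, k`. -/
abbrev Jet (p n k : ℕ) : Type := Euc p × ((m : Fin (k + 1)) → SymMul p n m)

/-- The base coordinates `x` of a jet. -/
def Jet.base {p n k : ℕ} (z : Jet p n k) : Euc p := z.1

/-- The coordinates `u` of order `0` of a jet. -/
def Jet.value {p n k : ℕ} (z : Jet p n k) : Euc n :=
  (z.2 ⟨0, Nat.succ_pos k⟩ : ContinuousMultilinearMap ℝ (fun _ : Fin 0 => Euc p) (Euc n))
    (fun _ => 0)

/-- `J^k(X, M)` for `X ⊆ ℝᵖ` and `M ⊆ ℝⁿ` open. -/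
def jetSpace {p n : ℕ} (X : Set (Euc p)) (M : Set (Euc n)) (k : ℕ) : Set (Jet p n k) :=
  {z | z.base ∈ X ∧ z.value ∈ M}

/-- The `k`-jet at `x` of (the graph of) `f`; thus `x ↦ jet k f x` is the prolonged graph
`j^k γ(f)`. The derivatives of a smooth function are symmetric, so that `symmetrize` does not
change them. -/
def jet {p n : ℕ} (k : ℕ) (f : Euc p → Euc n) (x : Euc p) : Jet p n k :=
  (x, fun m => symmetrize (iteratedFDeriv ℝ m f x))

/-- The Taylor polynomial with the given jet. -/
def Jet.taylor {p n k : ℕ} (z : Jet p n k) (y : Euc p) : Euc n :=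
  ∑ m : Fin (k + 1), (((m : ℕ).factorial : ℝ)⁻¹) •
    (z.2 m : ContinuousMultilinearMap ℝ (fun _ : Fin (m : ℕ) => Euc p) (Euc n))
      (fun _ => y - z.base)

section

variable {r : ℕ} {G : Type*} [TopologicalSpace G] [ChartedSpace (Euc r) G]
  {L : LocalLieGroup r G} {p n k : ℕ} {M : Set (Euc n)}

/-- The prolongation to `J^k(X, M)` of the verticalized action `g • (x, u) = (x, g • u)`:
the jet at `x` of a section `y ↦ (y, f y)` is sent to the jet at `x` of `y ↦ (y, g • f y)`,
which depends on the jet of `f` only; `f` is taken to be the Taylor polynomial. -/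
def LocalAction.prolong (A : LocalAction L M) (g : G) (z : Jet p n k) : Jet p n k :=
  jet k (fun y => A.act g (z.taylor y)) z.base

/-- `ψ` and `φ` are congruent at `x₀`: `ψ = g • φ` on a neighbourhood of `x₀`, for some `g`
(fixed-parameter congruence). -/
def LocalAction.Congruent (A : LocalAction L M) (ψ φ : Euc p → Euc n) (x₀ : Euc p) : Prop :=
  ∃ g : G, ∀ᶠ x in 𝓝 x₀, (g, φ x) ∈ A.dom ∧ ψ x = A.act g (φ x)

/-! ### Coframe fields -/

/-- A smooth coframe field on the open subset `U` of a normed space: one-forms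
`θ i`, indexed by a finite type, that are a basis of the cotangent space at each point. -/
structure IsCoframeOn {E : Type*} [NormedAddCommGroup E] [NormedSpace ℝ E] {ι : Type*}
    (U : Set E) (θ : ι → E → (E →L[ℝ] ℝ)) : Prop where
  smooth : ∀ i, ContDiffOn ℝ ∞ (θ i) U
  linearIndependent : ∀ z ∈ U, LinearIndependent ℝ (fun i => θ i z)
  span_eq_top : ∀ z ∈ U, Submodule.span ℝ (Set.range (fun i => θ i z)) = ⊤

/-- The exterior derivative of a one-form: `(dθ)(v, w)` at `z`. -/
def extDerivOne {E : Type*} [NormedAddCommGroup E] [NormedSpace ℝ E]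
    (θ : E → (E →L[ℝ] ℝ)) (z v w : E) : ℝ :=
  fderiv ℝ θ z v w - fderiv ℝ θ z w v

/-- The coframe field is of constant structure: in the structure equations
`dθⁱ = -1/2 ∑ Cⁱⱼₖ θʲ ∧ θᵏ`, `Cⁱⱼₖ = -Cⁱₖⱼ`, all `Cⁱⱼₖ` are constant. -/
def HasConstantStructureOn {E : Type*} [NormedAddCommGroup E] [NormedSpace ℝ E] {ι : Type*}
    [Fintype ι] (U : Set E) (θ : ι → E → (E →L[ℝ] ℝ)) : Prop :=
  ∃ C : ι → ι → ι → ℝ, (∀ i j l, C i j l = -C i l j) ∧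
    ∀ z ∈ U, ∀ (i : ι) (v w : E), extDerivOne (θ i) z v w =
      -(1 / 2 : ℝ) * ∑ j, ∑ l, C i j l * (θ j z v * θ l z w - θ j z w * θ l z v)

/-- The one-forms `θ i` on `U ⊆ J^k(X, M)` are invariant under the prolonged verticalized
action: `g^* θ i = θ i` wherever both sides are defined. -/
def LocalAction.IsInvariantCoframeOn (A : LocalAction L M) {ι : Type*} (U : Set (Jet p n k))
    (θ : ι → Jet p n k → (Jet p n k →L[ℝ] ℝ)) : Prop :=
  ∀ (g : G), ∀ z ∈ U, (g, z.value) ∈ A.dom → A.prolong g z ∈ U →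
    ∀ i, (θ i (A.prolong g z)).comp (fderiv ℝ (A.prolong g) z) = θ i z

/-! ### Immersions and complete systems of congruence invariants -/

/-- `φ` is a smooth immersion from the open subset `W` of `X` to `M`. -/
structure IsImmersionOn (X : Set (Euc p)) (M : Set (Euc n)) (W : Set (Euc p))
    (φ : Euc p → Euc n) : Prop where
  isOpen : IsOpen W
  subset : W ⊆ X
  smooth : ContDiffOn ℝ ∞ φ W
  mapsTo : MapsTo φ W M
  injective : ∀ x ∈ W, Function.Injective (fderiv ℝ φ x)

/-- The `N`-jets of those immersions (on open subsets of `X`, to `M`) whose `k`-jets lie in `U`. -/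
def immersiveJets (X : Set (Euc p)) (M : Set (Euc n)) (U : Set (Jet p n k)) (N : ℕ) :
    Set (Jet p n N) :=
  {z | ∃ (W : Set (Euc p)) (φ : Euc p → Euc n) (x : Euc p), IsImmersionOn X M W φ ∧ x ∈ W ∧
    jet k φ x ∈ U ∧ z = jet N φ x}

/-- `I` is a congruence invariant of differential order at most `N`: a smooth function of the
`N`-jets of immersions (whose `k`-jets lie in `U`) that is invariant under the prolonged
verticalized action. -/
structure LocalAction.IsCongruenceInvariant (A : LocalAction L M) (X : Set (Euc p))
    (U : Set (Jet p n k)) (N : ℕ) (I : Jet p n N → ℝ) : Prop where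
  smooth : ContDiffOn ℝ ∞ I (immersiveJets X M U N)
  invariant : ∀ (g : G), ∀ z ∈ immersiveJets X M U N, (g, z.value) ∈ A.dom →
    A.prolong g z ∈ immersiveJets X M U N → I (A.prolong g z) = I z

/-- `S` is a complete system of (finitely many) congruence invariants of differential order at
most `N`, for immersions whose `k`-jets lie in `U`: two immersions are congruent at a point `x₀` if
and only if their `k`-jets at `x₀` are in one orbit and the invariants in `S` take the
same values on both of them near `x₀`. -/
structure LocalAction.IsCompleteSystem (A : LocalAction L M) (X : Set (Euc p))
    (U : Set (Jet p n k)) (N : ℕ) (S : Set (Jet p n N → ℝ)) : Prop where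
  finite : S.Finite
  invariant : ∀ I ∈ S, A.IsCongruenceInvariant X U N I
  complete : ∀ (W : Set (Euc p)) (ψ φ : Euc p → Euc n), IsImmersionOn X M W ψ →
    IsImmersionOn X M W φ → ∀ x₀ ∈ W, jet k ψ x₀ ∈ U → jet k φ x₀ ∈ U →
    (A.Congruent ψ φ x₀ ↔
      (∃ g : G, (g, φ x₀) ∈ A.dom ∧ jet k ψ x₀ = A.prolong g (jet k φ x₀)) ∧
        ∀ᶠ x in 𝓝 x₀, ∀ I ∈ S, I (jet N ψ x) = I (jet N φ x))

end

end

/-! Along the prolonged graph of an immersion `φ`, the pullback of an invariant coframe `θ` has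
coefficients `θ i (jet k φ x) (fderiv ℝ (jet k φ) x v)`. By the chain rule for jets (`fderiv_jet`)
these are functions of the jet of order `k + 1`, and `G`-invariance of `θ` makes them congruence
invariants. Letting `v` run through a basis of `ℝᵖ` gives finitely many of them, and they are
claimed to be complete. Necessity is invariance. For sufficiency, the orbit condition at `x₀`
already supplies `g`, so no group element has to be constructed and only a uniqueness statement
remains. The maps `jet k ψ` and `jet k (g • φ)` agree at `x₀`; equality of the invariants, together
with invariance of `θ`, says that they pull `θ` back to the same forms. Equality of the pullbacks is
a first-order system that bounds the difference of the derivatives by the difference of the maps, so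
a Gronwall argument along segments from `x₀` shows that the maps agree near `x₀`
(`eventuallyEq_of_pullback_eq`). The coordinate of order zero then gives `ψ = g • φ`. The work on
jets justifies calculating with symmetric multilinear maps: derivatives are symmetric, Taylor
polynomials realize every jet, and the Faà di Bruno formula shows that the prolonged action is well
defined on jets and smooth. The least order and a minimal system follow from well-ordering and
finiteness. -/

/-! ### Rigidity of maps with the same pullback of a coframe -/

/-- Two `C¹` maps into a space with a coframe `Θ` that agree at a point and pull `Θ` back to the
same forms agree near that point. -/
theorem eventuallyEq_of_pullback_eq {E V Y : Type*} [NormedAddCommGroup E] [NormedSpace ℝ E]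
    [NormedAddCommGroup V] [NormedSpace ℝ V] [NormedAddCommGroup Y] [NormedSpace ℝ Y]
    {Θ : V → V →L[ℝ] Y} {F H : E → V} {x₀ : E}
    (hΘ : ContDiffAt ℝ 1 Θ (F x₀)) (hanti : ∃ c, AntilipschitzWith c (Θ (F x₀)))
    (hF : ContDiffAt ℝ 1 F x₀) (hH : ContDiffAt ℝ 1 H x₀) (h₀ : F x₀ = H x₀)
    (h : ∀ᶠ x in 𝓝 x₀, ∀ v, Θ (F x) (fderiv ℝ F x v) = Θ (H x) (fderiv ℝ H x v)) :
    F =ᶠ[𝓝 x₀] H := by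
  obtain ⟨c, hc⟩ := hanti
  obtain ⟨K, t, ht, hK⟩ := hΘ.exists_lipschitzOnWith
  have hcF := hF.continuousAt
  have hcH := hH.continuousAt
  have hdF : ∀ᶠ x in 𝓝 x₀, DifferentiableAt ℝ F x :=
    (hF.eventually (by simp)).mono fun x hx => hx.differentiableAt one_ne_zero
  have hdH : ∀ᶠ x in 𝓝 x₀, DifferentiableAt ℝ H x :=
    (hH.eventually (by simp)).mono fun x hx => hx.differentiableAt one_ne_zero
  have hcont : ContinuousAt (fderiv ℝ H) x₀ :=
    (hH.fderiv_right (m := 0) (by simp)).continuousAt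
  obtain ⟨B, hB⟩ : ∃ B, ∀ᶠ x in 𝓝 x₀, ‖fderiv ℝ H x‖ ≤ B :=
    ⟨‖fderiv ℝ H x₀‖ + 1, (hcont.norm.eventually_lt_const (by simp)).mono fun x hx => hx.le⟩
  -- The bound `1 / 2` lets the error of replacing `Θ (F x)` by `Θ (F x₀)` be absorbed into the
  -- left-hand side below; this absorption produces the factor `2` in `key`.
  have hΘc : ∀ᶠ x in 𝓝 x₀, (c : ℝ) * ‖Θ (F x) - Θ (F x₀)‖ ≤ 1 / 2 := by
    have h1 : ContinuousAt (fun x => (c : ℝ) * ‖Θ (F x) - Θ (F x₀)‖) x₀ :=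
      continuousAt_const.mul
        ((hΘ.continuousAt.comp_of_eq hcF rfl).sub continuousAt_const).norm
    exact (h1.eventually_lt_const (by simp)).mono fun x hx => hx.le
  obtain ⟨ε, hε, hball⟩ := Metric.eventually_nhds_iff_ball.1 (((((((hcF.eventually ht).and
    (hcH.eventually (h₀ ▸ ht))).and hdF).and hdH).and hB).and hΘc).and h)
  have key : ∀ x ∈ Metric.ball x₀ ε, ∀ v,
      ‖fderiv ℝ F x v - fderiv ℝ H x v‖ ≤ 2 * c * K * B * ‖v‖ * ‖F x - H x‖ := by
    intro x hx v
    obtain ⟨⟨⟨⟨⟨⟨hx1, hx2⟩, -⟩, -⟩, hx5⟩, hx6⟩, hx7⟩ := hball x hx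
    set w := fderiv ℝ F x v - fderiv ℝ H x v with hw
    -- Equal pullbacks turn the difference of derivatives into a difference of `Θ` at two points,
    -- which the Lipschitz bound controls by `‖F x - H x‖`.
    have e1 : Θ (F x) w = (Θ (H x) - Θ (F x)) (fderiv ℝ H x v) := by
      rw [hw, map_sub, hx7 v]
      simp
    have e2 : ‖w‖ ≤ c * ‖Θ (F x₀) w‖ := by
      simpa using hc.le_mul_dist w 0
    have e3 : ‖Θ (F x₀) w‖ ≤ ‖Θ (F x) w‖ + ‖Θ (F x) - Θ (F x₀)‖ * ‖w‖ := by
      have : Θ (F x₀) w = Θ (F x) w - (Θ (F x) - Θ (F x₀)) w := by simp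
      rw [this]
      exact (norm_sub_le _ _).trans (add_le_add le_rfl (ContinuousLinearMap.le_opNorm _ _))
    have e4 : ‖Θ (F x) w‖ ≤ K * ‖F x - H x‖ * (B * ‖v‖) := by
      rw [e1]
      refine (ContinuousLinearMap.le_opNorm _ _).trans ?_
      gcongr
      · rw [norm_sub_rev, ← dist_eq_norm, ← dist_eq_norm]
        exact hK.dist_le_mul _ hx1 _ hx2
      · exact (ContinuousLinearMap.le_opNorm _ _).trans (by gcongr)
    have e5 : c * (‖Θ (F x) - Θ (F x₀)‖ * ‖w‖) ≤ 1 / 2 * ‖w‖ := by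
      rw [← mul_assoc]
      gcongr
    have e6 : (c : ℝ) * ‖Θ (F x) w‖ ≤ c * (K * ‖F x - H x‖ * (B * ‖v‖)) := by gcongr
    have e7 := mul_le_mul_of_nonneg_left e3 c.2
    nlinarith
  filter_upwards [Metric.ball_mem_nhds x₀ hε] with x hx
  have hmem : ∀ s ∈ Icc (0 : ℝ) 1, x₀ + s • (x - x₀) ∈ Metric.ball x₀ ε := by
    intro s hs
    have hx' : ‖x - x₀‖ < ε := by simpa [dist_eq_norm] using hx
    rw [Metric.mem_ball, dist_eq_norm, add_sub_cancel_left, norm_smul, Real.norm_of_nonneg hs.1]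
    exact (mul_le_of_le_one_left (norm_nonneg _) hs.2).trans_lt hx'
  have hder : ∀ s ∈ Icc (0 : ℝ) 1, HasDerivAt
      (fun s : ℝ => F (x₀ + s • (x - x₀)) - H (x₀ + s • (x - x₀)))
      (fderiv ℝ F (x₀ + s • (x - x₀)) (x - x₀) - fderiv ℝ H (x₀ + s • (x - x₀)) (x - x₀)) s := by
    intro s hs
    obtain ⟨⟨⟨⟨⟨-, hs3⟩, hs4⟩, -⟩, -⟩, -⟩ := hball _ (hmem s hs)
    have hl : HasDerivAt (fun s : ℝ => x₀ + s • (x - x₀)) (x - x₀) s := by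
      simpa using ((hasDerivAt_id s).smul_const (x - x₀)).const_add x₀
    exact (hs3.hasFDerivAt.comp_hasDerivAt s hl).sub (hs4.hasFDerivAt.comp_hasDerivAt s hl)
  -- Gronwall on the segment from `x₀` to `x`: the difference vanishes at `s = 0`, hence at `s = 1`.
  have hzero := eq_zero_of_abs_deriv_le_mul_abs_self_of_eq_zero_right
    (fun s hs => (hder s hs).continuousAt.continuousWithinAt)
    (fun s hs => (hder s (Ico_subset_Icc_self hs)).hasDerivWithinAt)
    (by simp [h₀]) (fun s hs => key _ (hmem s (Ico_subset_Icc_self hs)) _) 1 (by simp)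
  simpa [sub_eq_zero] using hzero

/-- The one-forms of a coframe at a point define an injective linear map. -/
theorem IsCoframeOn.exists_antilipschitzWith {E : Type*} [NormedAddCommGroup E] [NormedSpace ℝ E]
    {ι : Type*} [Fintype ι] {U : Set E} {θ : ι → E → (E →L[ℝ] ℝ)} (hθ : IsCoframeOn U θ)
    {z : E} (hz : z ∈ U) :
    ∃ c, AntilipschitzWith c (ContinuousLinearMap.pi fun i => θ i z) := by
  have hker : LinearMap.ker (ContinuousLinearMap.pi fun i => θ i z : E →ₗ[ℝ] ι → ℝ) = ⊥ := by
    refine LinearMap.ker_eq_bot'.2 fun v hv => ?_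
    have hv' : ∀ i, θ i z v = 0 := fun i => congrFun hv i
    have hall : ∀ f : E →L[ℝ] ℝ, f v = 0 := by
      intro f
      have hf : f ∈ Submodule.span ℝ (Set.range fun i => θ i z) :=
        hθ.span_eq_top z hz ▸ Submodule.mem_top
      induction hf using Submodule.span_induction with
      | mem g hg => obtain ⟨i, rfl⟩ := hg; exact hv' i
      | zero => rfl
      | add f g _ _ hf hg => simp [hf, hg]
      | smul a f _ hf => simp [hf]
    exact SeparatingDual.eq_zero_of_forall_dual_eq_zero hall
  -- Finite dimension is a consequence of the finite coframe: `E` embeds in `ι → ℝ`.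
  have : FiniteDimensional ℝ E :=
    FiniteDimensional.of_injective _ (LinearMap.ker_eq_bot.1 hker)
  obtain ⟨c, -, hc⟩ := LinearMap.exists_antilipschitzWith _ hker
  exact ⟨c, hc⟩

/-- Rigidity for a coframe: maps that agree at a point and pull the coframe back to the same
forms agree near that point. -/
theorem IsCoframeOn.eventuallyEq {E V : Type*} [NormedAddCommGroup E] [NormedSpace ℝ E]
    [NormedAddCommGroup V] [NormedSpace ℝ V] {ι : Type*} [Fintype ι] {U : Set V} (hU : IsOpen U)
    {θ : ι → V → (V →L[ℝ] ℝ)} (hθ : IsCoframeOn U θ) {F H : E → V} {x₀ : E} (hx₀ : F x₀ ∈ U)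
    (hF : ContDiffAt ℝ 1 F x₀) (hH : ContDiffAt ℝ 1 H x₀) (h₀ : F x₀ = H x₀)
    (h : ∀ᶠ x in 𝓝 x₀, ∀ i v, θ i (F x) (fderiv ℝ F x v) = θ i (H x) (fderiv ℝ H x v)) :
    F =ᶠ[𝓝 x₀] H := by
  refine eventuallyEq_of_pullback_eq (Θ := fun z => ContinuousLinearMap.pi fun i => θ i z) ?_
    (hθ.exists_antilipschitzWith hx₀) hF hH h₀ (h.mono fun x hx v => funext fun i => hx i v)
  have hs : ∀ i, ContDiffAt ℝ 1 (θ i) (F x₀) := fun i =>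
    ((hθ.smooth i).contDiffAt (hU.mem_nhds hx₀)).of_le (by simp)
  exact (ContinuousLinearMap.piEquivL ℝ V fun _ : ι => ℝ).contDiff.contDiffAt.comp _ (contDiffAt_pi.2 hs)

theorem IsCoframeOn.contDiffOn_apply {E V : Type*} [NormedAddCommGroup E] [NormedSpace ℝ E]
    [NormedAddCommGroup V] [NormedSpace ℝ V] {ι : Type*} {U : Set V}
    {θ : ι → V → (V →L[ℝ] ℝ)} (hθ : IsCoframeOn U θ) (i : ι) {t d : E → V}
    (ht : ContDiff ℝ ∞ t) (hd : ContDiff ℝ ∞ d) :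
    ContDiffOn ℝ ∞ (fun z => θ i (t z) (d z)) (t ⁻¹' U) :=
  ((hθ.smooth i).comp ht.contDiffOn fun _ h => h).clm_apply hd.contDiffOn

/-! ### Symmetry of iterated derivatives -/

section

variable {E F : Type*} [NormedAddCommGroup E] [NormedSpace ℝ E] [NormedAddCommGroup F]
  [NormedSpace ℝ F]

/-- Adjacent transpositions suffice because they generate the symmetric group. Swapping the first
two arguments is the symmetry of the second derivative of `iteratedFDeriv ℝ m f`; any other adjacent
swap leaves the outermost derivative alone, so the identity of one order lower, valid at all nearby
points, can be differentiated. -/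
theorem ContDiffAt.iteratedFDeriv_comp_swap {f : E → F} {x : E} {m : ℕ}
    (hf : ContDiffAt ℝ (m + 1 : ℕ) f x) (i : Fin m) (v : Fin (m + 1) → E) :
    iteratedFDeriv ℝ (m + 1) f x (fun j => v (Equiv.swap i.castSucc i.succ j)) =
      iteratedFDeriv ℝ (m + 1) f x v := by
  induction m generalizing x with
  | zero => exact i.elim0
  | succ m ih =>
    have hev : ∀ᶠ y in 𝓝 x, ContDiffAt ℝ (m + 1 : ℕ) f y :=
      (hf.of_le (by norm_cast; simp)).eventually (by simp)
    have happ : ∀ a (w : Fin (m + 1) → E), fderiv ℝ (iteratedFDeriv ℝ (m + 1) f) x a w =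
        fderiv ℝ (fun y => iteratedFDeriv ℝ (m + 1) f y w) x a := by
      intro a w
      have := ((ContinuousMultilinearMap.apply ℝ (fun _ : Fin (m + 1) => E) F w).hasFDerivAt.comp x
        ((hf.iteratedFDeriv_right (m := 1) (i := m + 1)
          (by norm_cast; grind)).differentiableAt one_ne_zero).hasFDerivAt).fderiv
      exact (DFunLike.congr_fun this a).symm
    rw [iteratedFDeriv_succ_apply_left, iteratedFDeriv_succ_apply_left]
    induction i using Fin.cases with
    | zero =>
      have hD : ContDiffAt ℝ 2 (iteratedFDeriv ℝ m f) x :=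
        hf.iteratedFDeriv_right (m := 2) (i := m) (by norm_cast; grind)
      have hsymm : IsSymmSndFDerivAt ℝ (iteratedFDeriv ℝ m f) x :=
        hD.isSymmSndFDerivAt (by simp)
      have hsnd : ∀ a (w : Fin (m + 1) → E), fderiv ℝ (iteratedFDeriv ℝ (m + 1) f) x a w =
          fderiv ℝ (fderiv ℝ (iteratedFDeriv ℝ m f)) x a (w 0) (Fin.tail w) := by
        intro a w
        have hd : DifferentiableAt ℝ (fderiv ℝ (iteratedFDeriv ℝ m f)) x :=
          (hD.fderiv_right (m := 1) (by norm_num)).differentiableAt one_ne_zero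
        have := ((ContinuousMultilinearMap.apply ℝ (fun _ : Fin m => E) F
          (Fin.tail w)).hasFDerivAt.comp x (hd.hasFDerivAt.clm_apply
            (hasFDerivAt_const (w 0) x))).fderiv
        rw [happ]
        simp only [iteratedFDeriv_succ_apply_left]
        refine (DFunLike.congr_fun this a).trans ?_
        simp
      rw [hsnd, hsnd]
      have h0 : Equiv.swap (0 : Fin (m + 2)) 1 0 = 1 := Equiv.swap_apply_left _ _
      have h1 : Equiv.swap (0 : Fin (m + 2)) 1 1 = 0 := Equiv.swap_apply_right _ _
      simp only [Fin.tail, Fin.castSucc_zero, Fin.succ_zero_eq_one, h0, h1]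
      rw [hsymm]
      congr 1
    | succ i =>
      have h0 : Equiv.swap i.succ.castSucc i.succ.succ 0 = 0 :=
        Equiv.swap_apply_of_ne_of_ne (by simp [Fin.ext_iff]) (Fin.succ_ne_zero _).symm
      rw [h0, happ, happ]
      refine DFunLike.congr_fun (Filter.EventuallyEq.fderiv_eq ?_) _
      filter_upwards [hev] with y hy
      rw [← ih hy i (Fin.tail v)]
      congr 1
      funext j
      simp only [Fin.tail, Fin.castSucc_succ]
      exact congrArg v ((Fin.succ_injective _).swap_apply _ _ _)

/-- The `m`-th derivative of a `C^m` function is symmetric. -/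
theorem ContDiffAt.iteratedFDeriv_comp_perm_real {f : E → F} {x : E} {m : ℕ}
    (hf : ContDiffAt ℝ m f x) (σ : Equiv.Perm (Fin m)) (v : Fin m → E) :
    iteratedFDeriv ℝ m f x (fun i => v (σ i)) = iteratedFDeriv ℝ m f x v := by
  cases m with
  | zero => exact congrArg _ (Subsingleton.elim _ _)
  | succ m =>
    have hσ : σ ∈ Submonoid.closure (Set.range fun i : Fin m => Equiv.swap i.castSucc i.succ) :=
      Equiv.Perm.mclosure_swap_castSucc_succ m ▸ Submonoid.mem_top σ
    induction hσ using Submonoid.closure_induction generalizing v with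
    | mem τ hτ => obtain ⟨i, rfl⟩ := hτ; exact hf.iteratedFDeriv_comp_swap i v
    | one => rfl
    | mul σ τ _ _ hσ hτ => exact (hτ fun i => v (σ i)).trans (hσ v)

end

/-! ### Jets of functions -/

section

variable {p n k m : ℕ}

theorem coe_symmetrize_of_mem {T : ContinuousMultilinearMap ℝ (fun _ : Fin m => Euc p) (Euc n)}
    (hT : T ∈ SymMul p n m) :
    (symmetrize T : ContinuousMultilinearMap ℝ (fun _ : Fin m => Euc p) (Euc n)) = T := by
  have h : ∀ τ : Equiv.Perm (Fin m), T.domDomCongr τ = T := fun τ => by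
    ext1 v
    exact hT τ v
  simp only [symmetrize, h, Finset.sum_const, Finset.card_univ, Fintype.card_perm,
    Fintype.card_fin]
  rw [← Nat.cast_smul_eq_nsmul ℝ, smul_smul, inv_mul_cancel₀ (by positivity), one_smul]

theorem symmetrize_coe (T : SymMul p n m) : symmetrize T.1 = T :=
  Subtype.ext (coe_symmetrize_of_mem T.2)

/-- Symmetrization as a continuous linear map. -/
noncomputable def symmetrizeL (p n m : ℕ) :
    ContinuousMultilinearMap ℝ (fun _ : Fin m => Euc p) (Euc n) →L[ℝ] SymMul p n m :=
  (((m.factorial : ℝ)⁻¹) • ∑ τ : Equiv.Perm (Fin m),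
    ((ContinuousMultilinearMap.domDomCongrₗᵢ ℝ (Euc p) (Euc n) τ).toContinuousLinearEquiv :
      ContinuousMultilinearMap ℝ (fun _ : Fin m => Euc p) (Euc n) →L[ℝ] _)).codRestrict
    (SymMul p n m) fun T => by
      convert (symmetrize T).2
      simp [symmetrize]
      rfl

theorem symmetrizeL_apply (T : ContinuousMultilinearMap ℝ (fun _ : Fin m => Euc p) (Euc n)) :
    symmetrizeL p n m T = symmetrize T := by
  apply Subtype.ext
  simp [symmetrizeL, symmetrize]
  rfl

theorem contDiff_symmetrizeL : ContDiff ℝ ∞ (symmetrizeL p n m) :=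
  ContinuousLinearMap.contDiff (F := SymMul p n m) _

theorem iteratedFDeriv_mem_symMul {f : Euc p → Euc n} {x : Euc p} (hf : ContDiffAt ℝ m f x) :
    iteratedFDeriv ℝ m f x ∈ SymMul p n m :=
  fun σ v => hf.iteratedFDeriv_comp_perm_real σ v

/-- By symmetry of derivatives the symmetrization in `jet` is invisible on sufficiently regular
functions. -/
theorem coe_jet {f : Euc p → Euc n} {x : Euc p} (hf : ContDiffAt ℝ k f x) (m : Fin (k + 1)) :
    ((jet k f x).2 m : ContinuousMultilinearMap ℝ (fun _ : Fin (m : ℕ) => Euc p) (Euc n)) =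
      iteratedFDeriv ℝ m f x :=
  coe_symmetrize_of_mem (iteratedFDeriv_mem_symMul (hf.of_le (by exact_mod_cast m.is_le)))

@[simp]
theorem jet_base (f : Euc p → Euc n) (x : Euc p) : (jet k f x).base = x := rfl

-- No regularity of `f` is needed: every `0`-linear map is symmetric.
@[simp]
theorem jet_value (f : Euc p → Euc n) (x : Euc p) : (jet k f x).value = f x := by
  have h : iteratedFDeriv ℝ 0 f x ∈ SymMul p n 0 :=
    fun σ v => congrArg _ (Subsingleton.elim _ _)
  exact (DFunLike.congr_fun (coe_symmetrize_of_mem h) _).trans (by simp)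

theorem Filter.EventuallyEq.jet_eq {f g : Euc p → Euc n} {x : Euc p} (h : f =ᶠ[𝓝 x] g) :
    jet k f x = jet k g x := by
  simp only [jet, fun m => (Filter.EventuallyEq.iteratedFDeriv ℝ h m).eq_of_nhds]

theorem ContDiffAt.jet {f : Euc p → Euc n} {x : Euc p} (hf : ContDiffAt ℝ ∞ f x) :
    ContDiffAt ℝ ∞ (jet k f) x := by
  refine contDiffAt_id.prodMk (contDiffAt_pi.2 fun m => ?_)
  simp only [← symmetrizeL_apply]
  exact contDiff_symmetrizeL.contDiffAt.comp x
    (hf.iteratedFDeriv_right (m := ∞) (i := m) (by exact_mod_cast le_top))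

/-! ### Taylor polynomials -/

theorem Jet.contDiff_taylor (z : Jet p n k) : ContDiff ℝ ω z.taylor := by
  unfold Jet.taylor
  refine ContDiff.sum fun m _ => ContDiff.const_smul _ ?_
  exact (ContinuousMultilinearMap.contDiff _).comp (contDiff_pi.2 fun _ => contDiff_id.sub contDiff_const)

/-- The derivatives of the Taylor polynomial at the base point are the coordinates of the jet. -/
theorem Jet.iteratedFDeriv_taylor (z : Jet p n k) (m : Fin (k + 1)) :
    iteratedFDeriv ℝ m z.taylor z.base = (z.2 m).1 := by
  let q : FormalMultilinearSeries ℝ (Euc p) (Euc n) := fun j =>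
    if h : j < k + 1 then ((j.factorial : ℝ)⁻¹) • (z.2 ⟨j, h⟩).1 else 0
  have hq : HasFiniteFPowerSeriesOnBall z.taylor q z.base (k + 1) ⊤ := by
    refine HasFiniteFPowerSeriesOnBall.mk' (fun j hj => dif_neg hj.not_gt) (by simp) ?_
    intro y _
    rw [Finset.sum_range]
    refine Finset.sum_congr rfl fun i _ => ?_
    simp only [q, i.is_lt, dif_pos, add_sub_cancel_left]
    rfl
  ext1 v
  rw [hq.toHasFPowerSeriesOnBall.iteratedFDeriv_eq_sum z.contDiff_taylor.contDiffOn.analyticOn]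
  -- The `m`-th derivative is the sum of the permuted `m`-th coefficients; symmetry makes all `m!`
  -- terms equal, which cancels the Taylor factor.
  have h : ∀ σ : Equiv.Perm (Fin m), q m (fun i => v (σ i)) =
      (((m : ℕ).factorial : ℝ)⁻¹) • (z.2 m).1 v := fun σ => by
    simp only [q, m.is_lt, dif_pos, smul_apply]
    exact congrArg _ ((z.2 m).2 σ v)
  simp only [h, Finset.sum_const, Finset.card_univ, Fintype.card_perm, Fintype.card_fin]
  rw [← Nat.cast_smul_eq_nsmul ℝ, smul_smul, mul_inv_cancel₀ (by positivity), one_smul]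

theorem Jet.jet_taylor (z : Jet p n k) : jet k z.taylor z.base = z := by
  refine Prod.ext rfl (funext fun m => ?_)
  simp only [jet, z.iteratedFDeriv_taylor m, symmetrize_coe]

theorem Jet.taylor_base (z : Jet p n k) : z.taylor z.base = z.value := by
  rw [← jet_value (k := k) z.taylor, z.jet_taylor]

/-- The jet of a composition depends on the jet of the inner function only. -/
theorem jet_comp_congr {f h : Euc p → Euc n} {a : Euc n → Euc n} {x : Euc p}
    (hf : ContDiffAt ℝ k f x) (hh : ContDiffAt ℝ k h x) (ha : ContDiffAt ℝ k a (f x))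
    (hfh : jet k f x = jet k h x) :
    jet k (fun y => a (f y)) x = jet k (fun y => a (h y)) x := by
  have h₀ : f x = h x := by rw [← jet_value (k := k) f, hfh, jet_value]
  have hD : ∀ j ≤ k, ftaylorSeries ℝ f x j = ftaylorSeries ℝ h x j := fun j hj => by
    have := coe_jet hf ⟨j, Nat.lt_succ_of_le hj⟩
    rw [hfh, coe_jet hh] at this
    exact this.symm
  refine Prod.ext rfl (funext fun m => congrArg symmetrize ?_)
  have hm : ((m : ℕ) : ℕ∞ω) ≤ (k : ℕ∞ω) := by exact_mod_cast m.is_le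
  change iteratedFDeriv ℝ m (a ∘ f) x = iteratedFDeriv ℝ m (a ∘ h) x
  -- By Faà di Bruno, the derivatives of `f` enter only through orders at most `m ≤ k`.
  rw [iteratedFDeriv_comp ha hf hm, iteratedFDeriv_comp (h₀ ▸ ha) hh hm, h₀]
  refine Finset.sum_congr rfl fun c _ => ?_
  unfold FormalMultilinearSeries.compAlongOrderedFinpartition
  congr 1
  funext j
  exact hD _ ((c.partSize_le j).trans m.is_le)

end

/-! ### The prolonged action -/

section

variable {r : ℕ} {G : Type*} [TopologicalSpace G] [ChartedSpace (Euc r) G]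
  {L : LocalLieGroup r G} {p n k : ℕ} {M : Set (Euc n)}

theorem Jet.continuous_value : Continuous (Jet.value : Jet p n k → Euc n) := by
  have h : Continuous fun z : Jet p n k => (z.2 ⟨0, Nat.succ_pos k⟩).1 :=
    continuous_subtype_val.comp ((continuous_apply _).comp continuous_snd)
  exact ((ContinuousMultilinearMap.apply ℝ (fun _ : Fin 0 => Euc p) (Euc n)
    fun _ => 0).continuous).comp h

theorem Jet.contDiff_coord (m : Fin (k + 1)) :
    ContDiff ℝ ∞ fun z : Jet p n k => (z.2 m).1 := by
  have h₁ : ContDiff ℝ ∞ (SymMul p n m).subtypeL :=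
    ContinuousLinearMap.contDiff (E := SymMul p n m) _
  have h₂ : ContDiff ℝ ∞ fun z : Jet p n k => z.2 m := contDiff_pi.1 contDiff_snd m
  exact h₁.comp h₂

theorem Jet.contDiff_value : ContDiff ℝ ∞ (Jet.value : Jet p n k → Euc n) :=
  (ContinuousMultilinearMap.apply ℝ (fun _ : Fin 0 => Euc p) (Euc n)
    fun _ => 0).contDiff.comp (Jet.contDiff_coord ⟨0, Nat.succ_pos k⟩)

namespace LocalAction

variable (A : LocalAction L M) {g : G}

theorem isOpen_slice (g : G) : IsOpen {u | (g, u) ∈ A.dom} :=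
  A.isOpen_dom.preimage (by fun_prop)

theorem contDiffAt_act {u : Euc n} (hu : (g, u) ∈ A.dom) : ContDiffAt ℝ ∞ (A.act g) u := by
  rw [← contMDiffAt_iff_contDiffAt]
  have h := (A.contMDiffOn_act.contMDiffAt (A.isOpen_dom.mem_nhds hu))
  exact h.comp u (contMDiffAt_const.prodMk contMDiffAt_id)

/-- The Taylor polynomial used to define `prolong` has the same `k`-jet as `f`, and the jet of the
composition sees nothing else. The definition is thereby independent of the representative. -/
theorem prolong_jet {f : Euc p → Euc n} {x : Euc p} (hf : ContDiffAt ℝ ∞ f x)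
    (hg : (g, f x) ∈ A.dom) : A.prolong g (jet k f x) = jet k (fun y => A.act g (f y)) x := by
  have hk : (k : ℕ∞ω) ≤ ∞ := by exact_mod_cast le_top
  have h := (jet k f x).taylor_base
  rw [jet_value, jet_base] at h
  refine jet_comp_congr ((jet k f x).contDiff_taylor.contDiffAt.of_le le_top) (hf.of_le hk) ?_
    (jet k f x).jet_taylor
  exact (A.contDiffAt_act (by rwa [jet_base, h])).of_le hk

/-- The prolonged action of a group element is smooth. -/
theorem contDiffAt_prolong {z : Jet p n k} (hz : (g, z.value) ∈ A.dom) :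
    ContDiffAt ℝ ∞ (A.prolong g) z := by
  have hev : ∀ᶠ w in 𝓝 z, (g, w.value) ∈ A.dom :=
    Jet.continuous_value.continuousAt.preimage_mem_nhds ((A.isOpen_slice g).mem_nhds hz)
  refine ContDiffAt.prodMk contDiffAt_fst (contDiffAt_pi.2 fun m => ?_)
  have hk : ∀ {j}, j ≤ k → (j : ℕ∞ω) ≤ ∞ := fun _ => by exact_mod_cast le_top
  have hpart : ∀ (c : OrderedFinpartition m) (j), c.partSize j < k + 1 := fun c j =>
    Nat.lt_succ_of_le ((c.partSize_le j).trans m.is_le)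
  -- By Faà di Bruno, each coordinate of the prolonged jet is multilinear in the jet coordinates and
  -- in the derivatives of `A.act g` at the value, all of which depend smoothly on `w`.
  have hform : (fun w : Jet p n k => (A.prolong g w).2 m) =ᶠ[𝓝 z] fun w =>
      symmetrizeL p n m (∑ c : OrderedFinpartition m,
        c.compAlongOrderedFinpartitionL ℝ (Euc p) (Euc n) (Euc n)
          (iteratedFDeriv ℝ c.length (A.act g) w.value)
          fun j => (w.2 ⟨c.partSize j, hpart c j⟩).1) := by
    filter_upwards [hev] with w hw
    rw [symmetrizeL_apply]
    refine congrArg symmetrize ?_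
    have ha : ContDiffAt ℝ ∞ (A.act g) (w.taylor w.base) :=
      A.contDiffAt_act (by rwa [w.taylor_base])
    change iteratedFDeriv ℝ m (A.act g ∘ w.taylor) w.base = _
    rw [iteratedFDeriv_comp ha (w.contDiff_taylor.contDiffAt.of_le le_top) (hk m.is_le)]
    refine Finset.sum_congr rfl fun c _ => ?_
    rw [OrderedFinpartition.compAlongOrderedFinpartitionL_apply, w.taylor_base]
    unfold FormalMultilinearSeries.compAlongOrderedFinpartition
    congr 1
    funext j
    exact w.iteratedFDeriv_taylor ⟨_, hpart c j⟩
  refine ContDiffAt.congr_of_eventuallyEq ?_ hform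
  refine contDiff_symmetrizeL.contDiffAt.comp z (ContDiffAt.sum fun c _ => ?_)
  let B := c.compAlongOrderedFinpartitionL ℝ (Euc p) (Euc n) (Euc n)
  have hB : ContDiff ℝ ∞ fun q : (ContinuousMultilinearMap ℝ (fun _ : Fin c.length => Euc n) (Euc n)) ×
      ((i : Fin c.length) → ContinuousMultilinearMap ℝ (fun _ : Fin (c.partSize i) => Euc p) (Euc n)) =>
      B q.1 q.2 := by
    have : AnalyticOnNhd ℝ (fun q : (ContinuousMultilinearMap ℝ (fun _ : Fin c.length => Euc n) (Euc n)) ×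
      ((i : Fin c.length) → ContinuousMultilinearMap ℝ (fun _ : Fin (c.partSize i) => Euc p) (Euc n)) =>
      B q.1 q.2) univ := B.analyticOnNhd_uncurry_of_multilinear
    exact this.contDiff
  refine hB.contDiffAt.comp z (ContDiffAt.prodMk ?_ (contDiffAt_pi.2 fun j => ?_))
  · exact ((A.contDiffAt_act hz).iteratedFDeriv_right (m := ∞) (i := c.length)
      (by exact_mod_cast le_top)).comp z Jet.contDiff_value.contDiffAt
  · exact (Jet.contDiff_coord _).contDiffAt

end LocalAction

end

/-! ### Total derivatives and the invariants of a coframe -/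

section

variable {p n k : ℕ}

/-- The projection `J^{k+1}(X, M) → J^k(X, M)`. -/
noncomputable def Jet.trunc (z : Jet p n (k + 1)) : Jet p n k := (z.1, fun m => z.2 m.castSucc)

/-- The total derivative in the direction `v`: the derivative of `x ↦ jet k f x` as a function of
the jet of `f` of order `k + 1`. -/
noncomputable def Jet.totalDeriv (v : Euc p) (z : Jet p n (k + 1)) : Jet p n k :=
  -- The contraction of a symmetric map with `v` is already symmetric; `symmetrizeL` only places it
  -- in the subtype.
  (v, fun m => symmetrizeL p n m
    (continuousMultilinearCurryLeftEquiv ℝ (fun _ : Fin ((m : ℕ) + 1) => Euc p) (Euc n)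
      (z.2 m.succ).1 v))

theorem Jet.trunc_jet (f : Euc p → Euc n) (x : Euc p) : (jet (k + 1) f x).trunc = jet k f x := rfl

theorem Jet.contDiff_trunc : ContDiff ℝ ∞ (Jet.trunc : Jet p n (k + 1) → Jet p n k) :=
  contDiff_fst.prodMk (contDiff_pi.2 fun m => contDiff_pi.1 contDiff_snd m.castSucc)

theorem Jet.contDiff_totalDeriv (v : Euc p) :
    ContDiff ℝ ∞ (Jet.totalDeriv v : Jet p n (k + 1) → Jet p n k) := by
  refine contDiff_const.prodMk (contDiff_pi.2 fun m => contDiff_symmetrizeL.comp ?_)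
  have h : ContDiff ℝ ∞ fun z : Jet p n (k + 1) =>
      continuousMultilinearCurryLeftEquiv ℝ (fun _ : Fin ((m : ℕ) + 1) => Euc p) (Euc n)
        (z.2 m.succ).1 :=
    (LinearIsometryEquiv.contDiff _).comp (Jet.contDiff_coord m.succ)
  exact h.clm_apply contDiff_const

theorem ContinuousLinearMap.fderiv_comp_apply {E V Y : Type*} [NormedAddCommGroup E]
    [NormedSpace ℝ E] [NormedAddCommGroup V] [NormedSpace ℝ V] [NormedAddCommGroup Y]
    [NormedSpace ℝ Y] (Λ : V →L[ℝ] Y) {f : E → V} {x : E} (h : DifferentiableAt ℝ f x) (v : E) :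
    fderiv ℝ (fun y => Λ (f y)) x v = Λ (fderiv ℝ f x v) :=
  DFunLike.congr_fun (Λ.hasFDerivAt.comp x h.hasFDerivAt).fderiv v

/-- Each jet coordinate is a continuous linear image of an iterated derivative, so differentiating
raises its order by one. This is the source of the order `k + 1`. -/
theorem fderiv_jet {f : Euc p → Euc n} {x : Euc p} (hf : ContDiffAt ℝ ∞ f x) (v : Euc p) :
    fderiv ℝ (jet k f) x v = (jet (k + 1) f x).totalDeriv v := by
  have hd := (hf.jet (k := k)).differentiableAt (by simp)
  refine Prod.ext ?_ (funext fun m => ?_)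
  · have h := ContinuousLinearMap.fderiv_comp_apply (V := Jet p n k)
      (ContinuousLinearMap.fst ℝ (Euc p) ((m : Fin (k + 1)) → SymMul p n m)) hd v
    refine h.symm.trans ?_
    change fderiv ℝ (fun y => y) x v = v
    simp
  · have h := ContinuousLinearMap.fderiv_comp_apply (V := Jet p n k) (Y := SymMul p n m)
      ((ContinuousLinearMap.proj m).comp
        (ContinuousLinearMap.snd ℝ (Euc p) ((m : Fin (k + 1)) → SymMul p n m))) hd v
    have hm : DifferentiableAt ℝ (iteratedFDeriv ℝ m f) x :=
      (hf.iteratedFDeriv_right (m := ∞) (i := m)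
        (by exact_mod_cast le_top)).differentiableAt (by simp)
    have h' := ContinuousLinearMap.fderiv_comp_apply (Y := SymMul p n m) (symmetrizeL p n m) hm v
    simp only [symmetrizeL_apply] at h'
    refine h.symm.trans (h'.trans ?_)
    have hc : ((jet (k + 1) f x).2 m.succ).1 = iteratedFDeriv ℝ ((m : ℕ) + 1) f x :=
      coe_jet (hf.of_le (by exact_mod_cast le_top)) m.succ
    simp only [Jet.totalDeriv, hc, fderiv_iteratedFDeriv, symmetrizeL_apply]
    rfl

/-- The coefficient of a one-form along the total derivative in the direction `v`. -/
noncomputable def totalCoeff (θ : Jet p n k → (Jet p n k →L[ℝ] ℝ)) (v : Euc p) (z : Jet p n (k + 1)) : ℝ :=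
  θ z.trunc (z.totalDeriv v)

/-- Translates between the two roles of these coefficients: functions on jets of order `k + 1`, and
components of the pullback of `θ` by the prolonged graph. -/
theorem totalCoeff_jet (θ : Jet p n k → (Jet p n k →L[ℝ] ℝ)) {f : Euc p → Euc n} {x : Euc p}
    (hf : ContDiffAt ℝ ∞ f x) (v : Euc p) :
    totalCoeff θ v (jet (k + 1) f x) = θ (jet k f x) (fderiv ℝ (jet k f) x v) := by
  rw [fderiv_jet hf, totalCoeff, Jet.trunc_jet]

theorem IsCoframeOn.contDiffOn_totalCoeff {ι : Type*} {U : Set (Jet p n k)}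
    {θ : ι → Jet p n k → (Jet p n k →L[ℝ] ℝ)} (hθ : IsCoframeOn U θ) (i : ι) (v : Euc p) :
    ContDiffOn ℝ ∞ (totalCoeff (θ i) v) (Jet.trunc ⁻¹' U) :=
  hθ.contDiffOn_apply i Jet.contDiff_trunc (Jet.contDiff_totalDeriv v)

end

/-! ### Congruence of immersions -/

section

variable {r : ℕ} {G : Type*} [TopologicalSpace G] [ChartedSpace (Euc r) G]
  {L : LocalLieGroup r G} {p n k N : ℕ} {X : Set (Euc p)} {M : Set (Euc n)}

theorem IsImmersionOn.contDiffAt {W : Set (Euc p)} {φ : Euc p → Euc n}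
    (hφ : IsImmersionOn X M W φ) {x : Euc p} (hx : x ∈ W) : ContDiffAt ℝ ∞ φ x :=
  hφ.smooth.contDiffAt (hφ.isOpen.mem_nhds hx)

theorem IsImmersionOn.eventually_contDiffAt {W : Set (Euc p)} {φ : Euc p → Euc n}
    (hφ : IsImmersionOn X M W φ) {x : Euc p} (hx : x ∈ W) : ∀ᶠ y in 𝓝 x, ContDiffAt ℝ ∞ φ y :=
  (hφ.isOpen.eventually_mem hx).mono fun _ hy => hφ.contDiffAt hy

theorem trunc_mem_of_mem_immersiveJets {U : Set (Jet p n k)} {z : Jet p n (k + 1)}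
    (hz : z ∈ immersiveJets X M U (k + 1)) : z.trunc ∈ U := by
  obtain ⟨W, φ, x, -, -, hU, rfl⟩ := hz
  exact hU

theorem IsImmersionOn.eventually_jet_mem {U : Set (Jet p n k)} (hU : IsOpen U) {W : Set (Euc p)}
    {φ : Euc p → Euc n} (hφ : IsImmersionOn X M W φ) {x : Euc p} (hx : x ∈ W)
    (hxU : jet k φ x ∈ U) : ∀ᶠ y in 𝓝 x, jet k φ y ∈ U :=
  (hφ.contDiffAt hx).jet.continuousAt.preimage_mem_nhds (hU.mem_nhds hxU)

namespace LocalAction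

variable (A : LocalAction L M) {g : G}

theorem contDiffAt_act_comp {f : Euc p → Euc n} {x : Euc p} (hf : ContDiffAt ℝ ∞ f x)
    (hg : (g, f x) ∈ A.dom) : ContDiffAt ℝ ∞ (fun y => A.act g (f y)) x :=
  (A.contDiffAt_act hg).comp x hf

/-- The prolonged graphs of `f` and `g • f` pull an invariant coframe back to the same forms. -/
theorem IsInvariantCoframeOn.pullback_eq {A : LocalAction L M} {ι : Type*} {U : Set (Jet p n k)}
    {θ : ι → Jet p n k → (Jet p n k →L[ℝ] ℝ)} (hinv : A.IsInvariantCoframeOn U θ)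
    {f : Euc p → Euc n} {x : Euc p} (hf : ∀ᶠ y in 𝓝 x, ContDiffAt ℝ ∞ f y)
    (hg : (g, f x) ∈ A.dom) (hU : jet k f x ∈ U) (hgU : jet k (fun y => A.act g (f y)) x ∈ U)
    (i : ι) (v : Euc p) :
    θ i (jet k (fun y => A.act g (f y)) x) (fderiv ℝ (jet k fun y => A.act g (f y)) x v) =
      θ i (jet k f x) (fderiv ℝ (jet k f) x v) := by
  have hfx := hf.self_of_nhds
  have hdom : ∀ᶠ y in 𝓝 x, (g, f y) ∈ A.dom :=
    hfx.continuousAt.preimage_mem_nhds ((A.isOpen_slice g).mem_nhds hg)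
  have hval : (g, (jet k f x).value) ∈ A.dom := by rwa [jet_value]
  -- The identity must hold on a neighbourhood, since it is differentiated next.
  have heq : (jet k fun y => A.act g (f y)) =ᶠ[𝓝 x] A.prolong g ∘ jet k f := by
    filter_upwards [hf, hdom] with y hy hy'
    exact (A.prolong_jet hy hy').symm
  have hchain := fderiv_comp x ((A.contDiffAt_prolong hval).differentiableAt (by simp))
    ((hfx.jet (k := k)).differentiableAt (by simp))
  have h := DFunLike.congr_fun (hinv g _ hU hval (by rwa [A.prolong_jet hfx hg]) i)
    (fderiv ℝ (jet k f) x v)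
  rw [heq.fderiv_eq, hchain, ← A.prolong_jet hfx hg]
  exact h

/-- The coefficients of an invariant coframe along the total derivatives are congruence
invariants. -/
theorem IsInvariantCoframeOn.isCongruenceInvariant {A : LocalAction L M} {ι : Type*}
    {U : Set (Jet p n k)} {θ : ι → Jet p n k → (Jet p n k →L[ℝ] ℝ)}
    (hinv : A.IsInvariantCoframeOn U θ) (hθ : IsCoframeOn U θ) (i : ι) (v : Euc p) :
    A.IsCongruenceInvariant X U (k + 1) (totalCoeff (θ i) v) where
  smooth := (hθ.contDiffOn_totalCoeff i v).mono fun _ => trunc_mem_of_mem_immersiveJets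
  invariant := by
    rintro g _ ⟨W, φ, x, hφ, hx, hU, rfl⟩ hg hgz
    rw [jet_value] at hg
    have hφx := hφ.contDiffAt hx
    rw [A.prolong_jet hφx hg] at hgz ⊢
    rw [totalCoeff_jet _ hφx, totalCoeff_jet _ (A.contDiffAt_act_comp hφx hg)]
    exact hinv.pullback_eq (hφ.eventually_contDiffAt hx) hg hU
      (trunc_mem_of_mem_immersiveJets hgz) i v

/-- Congruent immersions have jets in one orbit and the same congruence invariants. -/
theorem Congruent.necessary {A : LocalAction L M} {U : Set (Jet p n k)} (hU : IsOpen U)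
    {S : Set (Jet p n N → ℝ)} (hS : ∀ I ∈ S, A.IsCongruenceInvariant X U N I)
    {W : Set (Euc p)} {ψ φ : Euc p → Euc n} (hψ : IsImmersionOn X M W ψ)
    (hφ : IsImmersionOn X M W φ) {x₀ : Euc p} (hx₀ : x₀ ∈ W) (hψU : jet k ψ x₀ ∈ U)
    (hφU : jet k φ x₀ ∈ U) (h : A.Congruent ψ φ x₀) :
    (∃ g : G, (g, φ x₀) ∈ A.dom ∧ jet k ψ x₀ = A.prolong g (jet k φ x₀)) ∧
      ∀ᶠ x in 𝓝 x₀, ∀ I ∈ S, I (jet N ψ x) = I (jet N φ x) := by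
  obtain ⟨g, hg⟩ := h
  have hjet : ∀ j, ∀ᶠ x in 𝓝 x₀, (g, φ x) ∈ A.dom ∧ ContDiffAt ℝ ∞ φ x ∧
      jet j ψ x = A.prolong g (jet j φ x) := by
    intro j
    -- Equality of jets at `x` needs `ψ = g • φ` near `x`, not just at `x`.
    filter_upwards [hg.eventually_nhds, hφ.eventually_contDiffAt hx₀] with x hx hφx
    have hgx := hx.self_of_nhds.1
    refine ⟨hgx, hφx, ?_⟩
    rw [A.prolong_jet hφx hgx]
    exact Filter.EventuallyEq.jet_eq (hx.mono fun y hy => hy.2)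
  refine ⟨⟨g, (hjet k).self_of_nhds.1, (hjet k).self_of_nhds.2.2⟩, ?_⟩
  filter_upwards [hjet N, hφ.isOpen.eventually_mem hx₀, hφ.eventually_jet_mem hU hx₀ hφU,
    hψ.eventually_jet_mem hU hx₀ hψU] with x ⟨hgx, _, hj⟩ hxW hxφ hxψ I hI
  rw [hj]
  refine (hS I hI).invariant g _ ⟨W, φ, x, hφ, hxW, hxφ, rfl⟩ (by rwa [jet_value]) ?_
  exact ⟨W, ψ, x, hψ, hxW, hxψ, hj.symm⟩

/-- An invariant coframe on an open set of jets of order `k` gives a complete system of congruence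
invariants of differential order `k + 1`. -/
theorem IsInvariantCoframeOn.isCompleteSystem {A : LocalAction L M} {ι : Type*} [Fintype ι]
    {U : Set (Jet p n k)} (hU : IsOpen U) {θ : ι → Jet p n k → (Jet p n k →L[ℝ] ℝ)}
    (hθ : IsCoframeOn U θ) (hinv : A.IsInvariantCoframeOn U θ) :
    A.IsCompleteSystem X U (k + 1) (Set.range fun q : ι × Fin p =>
      totalCoeff (θ q.1) ((EuclideanSpace.basisFun (Fin p) ℝ).toBasis q.2)) where
  finite := Set.finite_range _
  invariant := by
    rintro _ ⟨q, rfl⟩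
    exact hinv.isCongruenceInvariant hθ _ _
  complete := by
    intro W ψ φ hψ hφ x₀ hx₀ hψU hφU
    refine ⟨Congruent.necessary hU ?_ hψ hφ hx₀ hψU hφU, ?_⟩
    · rintro _ ⟨q, rfl⟩
      exact hinv.isCongruenceInvariant hθ _ _
    rintro ⟨⟨g, hg, hjet⟩, hI⟩
    have hφx := hφ.contDiffAt hx₀
    have hdom : ∀ᶠ y in 𝓝 x₀, (g, φ y) ∈ A.dom :=
      hφx.continuousAt.preimage_mem_nhds ((A.isOpen_slice g).mem_nhds hg)
    rw [A.prolong_jet hφx hg] at hjet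
    have hcomp := A.contDiffAt_act_comp hφx hg
    have hgU : ∀ᶠ y in 𝓝 x₀, jet k (fun y => A.act g (φ y)) y ∈ U :=
      hcomp.jet.continuousAt.preimage_mem_nhds (hU.mem_nhds (hjet ▸ hψU))
    have hψx := (hψ.contDiffAt hx₀).jet (k := k)
    -- Rigidity is applied in the jet space, where the coframe lives, rather than to `ψ` and `g • φ`
    -- themselves.
    have key : jet k ψ =ᶠ[𝓝 x₀] jet k fun y => A.act g (φ y) := by
      refine hθ.eventuallyEq hU hψU (hψx.of_le (by simp)) (hcomp.jet.of_le (by simp)) hjet ?_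
      filter_upwards [hI, hdom, hgU, hφ.eventually_jet_mem hU hx₀ hφU,
        hψ.eventually_contDiffAt hx₀, (hφ.eventually_contDiffAt hx₀).eventually_nhds]
        with x hIx hgx hgUx hφUx hψx hφx i v
      rw [hinv.pullback_eq hφx hgx hφUx hgUx]
      -- The invariants give equality on basis vectors only; linearity in `v` extends it to the
      -- whole pullback.
      have hlin : (θ i (jet k ψ x)).toLinearMap ∘ₗ (fderiv ℝ (jet k ψ) x).toLinearMap =
          (θ i (jet k φ x)).toLinearMap ∘ₗ (fderiv ℝ (jet k φ) x).toLinearMap := by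
        refine (EuclideanSpace.basisFun (Fin p) ℝ).toBasis.ext fun j => ?_
        have h := hIx _ ⟨(i, j), rfl⟩
        dsimp only at h
        rwa [totalCoeff_jet _ hψx, totalCoeff_jet _ hφx.self_of_nhds] at h
      exact LinearMap.congr_fun hlin v
    refine ⟨g, ?_⟩
    filter_upwards [hdom, key] with x hgx hx
    exact ⟨hgx, by rw [← jet_value (k := k) ψ, hx, jet_value]⟩

/-- A finite set has finitely many subsets, so some complete subset `T` of `S` is minimal among
these. It is minimal outright, because any complete set inside `T` is again a subset of `S`. -/
theorem IsCompleteSystem.exists_minimal {A : LocalAction L M} {U : Set (Jet p n k)}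
    {S : Set (Jet p n N → ℝ)} (hS : A.IsCompleteSystem X U N S) :
    ∃ T, Minimal (A.IsCompleteSystem X U N) T := by
  obtain ⟨T, -, hT⟩ := (hS.finite.finite_subsets.inter_of_left
    {T | A.IsCompleteSystem X U N T}).exists_le_minimal ⟨Subset.rfl, hS⟩
  refine ⟨T, hT.prop.2, fun T' hT' hle => hT.le_of_le ⟨hle.trans hT.prop.1, hT'⟩ hle⟩

end LocalAction

end

/-- If `J^k(X, M)` (or an open subset `U` of it) admits a coframe field of constant structure that
is invariant under the prolonged verticalized action, then the least order `d` of a complete system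
of congruence invariants is at most `k + 1`, and there is a complete system of order `d` from
which no member can be omitted. -/
theorem corollary4p11 {r p n k : ℕ} {G : Type*} [TopologicalSpace G] [ChartedSpace (Euc r) G]
    [IsManifold (𝓡 r) ∞ G] (L : LocalLieGroup r G)
    (X : Set (Euc p)) (hX : IsOpen X) (M : Set (Euc n)) (hM : IsOpen M)
    (A : LocalAction L M)
    (U : Set (Jet p n k)) (hU : IsOpen U) (hUJ : U ⊆ jetSpace X M k)
    {ι : Type*} [Fintype ι] (θ : ι → Jet p n k → (Jet p n k →L[ℝ] ℝ))
    (hθ : IsCoframeOn U θ) (hconst : HasConstantStructureOn U θ)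
    (hinv : A.IsInvariantCoframeOn U θ) :
    ∃ d : ℕ, d ≤ k + 1 ∧
      IsLeast {N : ℕ | ∃ S : Set (Jet p n N → ℝ), A.IsCompleteSystem X U N S} d ∧
      ∃ S : Set (Jet p n d → ℝ), Minimal (A.IsCompleteSystem X U d) S := by
  have hex : ∃ N : ℕ, ∃ S : Set (Jet p n N → ℝ), A.IsCompleteSystem X U N S :=
    ⟨k + 1, _, hinv.isCompleteSystem hU hθ⟩
  classical
  obtain ⟨S, hS⟩ := Nat.find_spec hex
  exact ⟨Nat.find hex, Nat.find_min' hex ⟨_, hinv.isCompleteSystem hU hθ⟩,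
    ⟨⟨S, hS⟩, fun N hN => Nat.find_min' hex hN⟩, hS.exists_minimal⟩
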